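/- Let $\mathbf{M}$ be a countable relational structure with domain $\Omega$, and let $G=\mathrm{Aut}(\mathbf{M})\leq\mathrm{Sym}(\Omega)$, equipped with the topology of pointwise convergence ($\Omega$ being discrete). For $A\subseteq\Omega$ let $G_A=\{g\in G\colon \forall a\in A,\ g(a)=a\}$ be its pointwise stabilizer. Assume the following. (1) $\mathbf{M}$ is ultrahomogeneous: every embedding of a finite substructure of $\mathbf{M}$ into $\mathbf{M}$ extends to an automorphism of $\mathbf{M}$. (2) $G$ weakly eliminates imaginaries: for every open subgroup $V\leq G$ there is a finite subset $A\subseteq\Omega$ such that $G_A\leq V$ and $[V:G_A]<+\infty$. (3) $\mathbf{M}$ has the strong cofinite amalgamation property over countable subsets ($\sigma$-SAP): let $\sigma\mathrm{Age}(\mathbf{M})$ be the class of countable (finite or infinite, possibly empty) structures that are isomorphic to a substructure of $\mathbf{M}$; whenever $\mathbf{A},\mathbf{B}_1,\mathbf{B}_2\in\sigma\mathrm{Age}(\mathbf{M})$ and $f_i\colon\mathbf{A}\to\mathbf{B}_i$ ($i=1,2$) are embeddings such that $\mathrm{dom}(\mathbf{B}_i)\setminus f_i(\mathrm{dom}(\mathbf{A}))$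 is finite, there exist $\mathbf{C}\in\sigma\mathrm{Age}(\mathbf{M})$ and embeddings $g_i\colon\mathbf{B}_i\to\mathbf{C}$ such that $g_1\circ f_1=g_2\circ f_2$, and such that for all $b_1\in\mathrm{dom}(\mathbf{B}_1)$, $b_2\in\mathrm{dom}(\mathbf{B}_2)$ with $g_1(b_1)=g_2(b_2)$ there is $a\in\mathrm{dom}(\mathbf{A})$ with $f_1(a)=b_1$ and $f_2(a)=b_2$. Then $G$ is dissociated: for every unitary representation $\pi\colon G\to\mathcal{U}(\mathcal{H})$ on a complex Hilbert space, continuous for the strong operator topology, and for all finite subsets $A,B\subseteq\Omega$, one has \[p_Ap_B=p_{A\cap B},\] where $p_A$ denotes the orthogonal projection of $\mathcal{H}$ onto the subspace $\mathcal{H}_A=\{\xi\in\mathcal{H}\colon \pi(g)\xi=\xi \text{ for all } g\in G_A\}$. -/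

import Mathlib

open scoped FirstOrder

universe u v w x

namespace Dissociation

/-! ### Permutation groups -/

section PermutationGroups

variable {Ω : Type w}

/-- The topology of pointwise convergence on `Sym(Ω)`, where `Ω` is discrete.
Subgroups of `Sym(Ω)` carry the subspace topology. -/
instance permTopology : TopologicalSpace (Equiv.Perm Ω) :=
  TopologicalSpace.induced (fun g : Equiv.Perm Ω => (g : Ω → Ω))
    (@Pi.topologicalSpace Ω (fun _ => Ω) (fun _ => ⊥))

/-- The pointwise stabilizer `G_A` of `A ⊆ Ω` in a permutation group `G ≤ Sym(Ω)`. -/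
abbrev pointwiseStabilizer (G : Subgroup (Equiv.Perm Ω)) (A : Set Ω) : Subgroup G :=
  fixingSubgroup G A

/-- `G` weakly eliminates imaginaries: every open subgroup `V` of `G` contains, with finite
index, the pointwise stabilizer of some finite set. -/
def WeaklyEliminatesImaginaries (G : Subgroup (Equiv.Perm Ω)) : Prop :=
  ∀ V : Subgroup G, IsOpen (V : Set G) →
    ∃ A : Set Ω, A.Finite ∧ pointwiseStabilizer G A ≤ V ∧
      (pointwiseStabilizer G A).IsFiniteRelIndex V

/-- A unitary representation of `G` on a complex Hilbert space `H`: a homomorphism to the unitary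
group of `H` that is continuous for the strong operator topology. -/
structure UnitaryRep (G : Subgroup (Equiv.Perm Ω)) (H : Type x)
    [NormedAddCommGroup H] [InnerProductSpace ℂ H] [CompleteSpace H] where
  toMonoidHom : G →* unitary (H →L[ℂ] H)
  continuous_apply : ∀ ξ : H, Continuous fun g : G => (toMonoidHom g : H →L[ℂ] H) ξ

namespace UnitaryRep

variable {G : Subgroup (Equiv.Perm Ω)} {H : Type x}
  [NormedAddCommGroup H] [InnerProductSpace ℂ H] [CompleteSpace H]

/-- The operator `π(g)`. -/
noncomputable def op (π : UnitaryRep G H) (g : G) : H →L[ℂ] H := (π.toMonoidHom g : H →L[ℂ] H)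

/-- The subspace `H_A` of the vectors that are invariant under `G_A`. -/
noncomputable def invariants (π : UnitaryRep G H) (A : Set Ω) : Submodule ℂ H where
  carrier := {ξ | ∀ g ∈ pointwiseStabilizer G A, π.op g ξ = ξ}
  add_mem' := fun ha hb g hg => by rw [map_add, ha g hg, hb g hg]
  zero_mem' := fun g _ => map_zero (π.op g)
  smul_mem' := fun c ξ hξ g hg => by rw [map_smul, hξ g hg]

theorem isClosed_invariants (π : UnitaryRep G H) (A : Set Ω) :
    IsClosed (π.invariants A : Set H) := by
  have h : (π.invariants A : Set H) =
      ⋂ g ∈ pointwiseStabilizer G A, {ξ | π.op g ξ = ξ} := by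
    ext ξ
    simp only [Set.mem_iInter]
    rfl
  rw [h]
  exact isClosed_biInter fun g _ => isClosed_eq (π.op g).continuous continuous_id

instance hasOrthogonalProjection_invariants (π : UnitaryRep G H) (A : Set Ω) :
    (π.invariants A).HasOrthogonalProjection :=
  haveI : CompleteSpace (π.invariants A) := (π.isClosed_invariants A).completeSpace_coe
  inferInstance

/-- The orthogonal projection `p_A` of `H` onto `H_A`. -/
noncomputable def proj (π : UnitaryRep G H) (A : Set Ω) : H →L[ℂ] H :=
  (π.invariants A).starProjection

/-- The representation is dissociated: `p_A p_B = p_{A ∩ B}` for all finite `A, B ⊆ Ω`. -/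
def IsDissociated (π : UnitaryRep G H) : Prop :=
  ∀ A B : Set Ω, A.Finite → B.Finite → π.proj A ∘L π.proj B = π.proj (A ∩ B)

end UnitaryRep

/-- `G` is dissociated: each of its unitary representations is dissociated. -/
def IsDissociated (G : Subgroup (Equiv.Perm Ω)) : Prop :=
  ∀ (H : Type x) [NormedAddCommGroup H] [InnerProductSpace ℂ H] [CompleteSpace H]
    (π : UnitaryRep G H), π.IsDissociated

end PermutationGroups

/-! ### Structures -/

section Structures

variable (L : FirstOrder.Language.{u, v}) (M : Type w) [L.Structure M]

/-- The automorphism group of `M`, as a subgroup of `Sym(M)`. -/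
def automorphismGroup : Subgroup (Equiv.Perm M) where
  carrier := {g | ∃ φ : M ≃[L] M, φ.toEquiv = g}
  one_mem' := ⟨FirstOrder.Language.Equiv.refl L M, rfl⟩
  mul_mem' := by
    rintro _ _ ⟨φ, rfl⟩ ⟨ψ, rfl⟩
    exact ⟨φ.comp ψ, rfl⟩
  inv_mem' := by
    rintro _ ⟨φ, rfl⟩
    exact ⟨φ.symm, rfl⟩

/-- The countable (finite or infinite) structures that embed into `M`. -/
def sigmaAge : Set (CategoryTheory.Bundled.{w} L.Structure) :=
  {N | Countable N ∧ Nonempty (N ↪[L] M)}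

/-- The strong cofinite amalgamation property over countable subsets (`σ`-SAP). -/
def SigmaSAP : Prop :=
  ∀ (A B₁ B₂ : CategoryTheory.Bundled.{w} L.Structure) (f₁ : A ↪[L] B₁) (f₂ : A ↪[L] B₂),
    A ∈ sigmaAge L M → B₁ ∈ sigmaAge L M → B₂ ∈ sigmaAge L M →
    (Set.range f₁)ᶜ.Finite → (Set.range f₂)ᶜ.Finite →
    ∃ (C : CategoryTheory.Bundled.{w} L.Structure) (g₁ : B₁ ↪[L] C) (g₂ : B₂ ↪[L] C),
      C ∈ sigmaAge L M ∧ g₁.comp f₁ = g₂.comp f₂ ∧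
      ∀ (b₁ : B₁) (b₂ : B₂), g₁ b₁ = g₂ b₂ → ∃ a : A, f₁ a = b₁ ∧ f₂ a = b₂

end Structures

end Dissociation

/-! Amalgamating two copies of `M` over a cofinite set `Y` gives self-embeddings `φ₁`, `φ₂` that
agree on `Y` and have otherwise disjoint images; ultrahomogeneity makes each a pointwise limit of
automorphisms (`SigmaSAP.hasIndependentCopies`). This excludes algebraicity, so weak elimination of
imaginaries gives `H_A ∩ H_B = H_{A ∩ B}` (`mem_invariants_inter`). For finite `Z`, let `K` be the
closed span of the `H_F` with `F` finite and disjoint from `Z`. With `Y = Zᶜ`, both limits act alike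
on `K`, so they send a vector of `H_B ∩ K` into `H_{φ₁(B)} ∩ H_{φ₂(B)} = H_{φ₁(B \ Z)}`; hence it
lies in `H_{B \ Z}` (`mem_invariants_diff`). For `Z = B \ A`, projecting `H_B` to `K ⊇ H_A` lands in
`H_{A ∩ B}`, which is dissociation. -/

namespace Dissociation

/-! ### Open subgroups, algebraicity and weak elimination of imaginaries. -/

section PermutationGroups

variable {Ω : Type w}

/-- The elements that agree with a given one on a finite set form an open set. -/
theorem isOpen_setOf_eqOn (G : Subgroup (Equiv.Perm Ω)) {A : Set Ω} (hA : A.Finite) (h : G) :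
    IsOpen {g : G | ∀ a ∈ A, g • a = h • a} := by
  have hset : {g : G | ∀ a ∈ A, g • a = h • a} = ⋂ a ∈ A, {g : G | g • a = h • a} := by
    ext g
    simp
  rw [hset]
  refine hA.isOpen_biInter fun a _ => ?_
  let : TopologicalSpace Ω := ⊥
  have : DiscreteTopology Ω := ⟨rfl⟩
  have hc : Continuous fun g : G => ((g : Equiv.Perm Ω) : Ω → Ω) a :=
    (continuous_apply a).comp (continuous_induced_dom.comp continuous_subtype_val)
  exact (isOpen_discrete {h • a}).preimage hc

theorem isOpen_of_pointwiseStabilizer_le (G : Subgroup (Equiv.Perm Ω)) {A : Set Ω}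
    (hA : A.Finite) {V : Subgroup G} (hV : pointwiseStabilizer G A ≤ V) :
    IsOpen (V : Set G) := by
  rw [isOpen_iff_forall_mem_open]
  intro v hv
  refine ⟨_, fun g hg => ?_, isOpen_setOf_eqOn G hA v, fun a _ => rfl⟩
  have hmem : v⁻¹ * g ∈ V := hV ((mem_fixingSubgroup_iff G).2 fun a ha => by
    rw [mul_smul, hg a ha, inv_smul_smul])
  simpa using V.mul_mem hv hmem

/-- `G` has no algebraicity: the pointwise stabilizer of a finite set has no finite orbit outside
of that set. -/
def NoAlgebraicity (G : Subgroup (Equiv.Perm Ω)) : Prop :=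
  ∀ A : Set Ω, A.Finite → ∀ d : Ω,
    {x | ∃ g ∈ pointwiseStabilizer G A, g • d = x}.Finite → d ∈ A

/-- The orbits of points of `A` are finite under a group that contains the pointwise stabilizer
of `A` with finite index. -/
theorem finite_orbit_of_isFiniteRelIndex {G : Subgroup (Equiv.Perm Ω)} {A : Set Ω}
    {V : Subgroup G} (hV : (pointwiseStabilizer G A).IsFiniteRelIndex V) {d : Ω} (hd : d ∈ A) :
    {x | ∃ g ∈ V, g • d = x}.Finite := by
  have hle : (pointwiseStabilizer G A).subgroupOf V ≤ MulAction.stabilizer V d := fun v hv =>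
    (mem_fixingSubgroup_iff G).1 (Subgroup.mem_subgroupOf.1 hv) d hd
  have : ((pointwiseStabilizer G A).subgroupOf V).FiniteIndex :=
    hV.to_finiteIndex_subgroupOf
  have := Subgroup.finiteIndex_of_le hle
  have hfin : (MulAction.orbit V d).Finite :=
    Set.finite_coe_iff.1 (Finite.of_equiv _ (MulAction.orbitEquivQuotientStabilizer V d).symm)
  refine hfin.subset ?_
  rintro _ ⟨g, hg, rfl⟩
  exact ⟨⟨g, hg⟩, rfl⟩

/-- Under weak elimination of imaginaries and no algebraicity, the stabilizers of two finite sets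
generate the stabilizer of their intersection. -/
theorem pointwiseStabilizer_inter_le_sup {G : Subgroup (Equiv.Perm Ω)}
    (hWEI : WeaklyEliminatesImaginaries G) (hG : NoAlgebraicity G) {A B : Set Ω}
    (hA : A.Finite) (hB : B.Finite) :
    pointwiseStabilizer G (A ∩ B) ≤ pointwiseStabilizer G A ⊔ pointwiseStabilizer G B := by
  obtain ⟨D, -, hDV, hfin⟩ := hWEI (pointwiseStabilizer G A ⊔ pointwiseStabilizer G B)
    (isOpen_of_pointwiseStabilizer_le G hA le_sup_left)
  -- It suffices that `D ⊆ A ∩ B`: a point of `D` has a finite orbit under the join, hence under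
  -- `G_A` and under `G_B`.
  refine le_trans (fixingSubgroup_antitone G Ω fun d hd => ⟨?_, ?_⟩) hDV
  · refine hG A hA d ((finite_orbit_of_isFiniteRelIndex hfin hd).subset ?_)
    rintro _ ⟨g, hg, rfl⟩
    exact ⟨g, le_sup_left (α := Subgroup G) hg, rfl⟩
  · refine hG B hB d ((finite_orbit_of_isFiniteRelIndex hfin hd).subset ?_)
    rintro _ ⟨g, hg, rfl⟩
    exact ⟨g, le_sup_right (α := Subgroup G) hg, rfl⟩

/-! ### Invariant vectors and closed spans of invariant subspaces. -/

namespace UnitaryRep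

variable {G : Subgroup (Equiv.Perm Ω)} {H : Type x}
  [NormedAddCommGroup H] [InnerProductSpace ℂ H] [CompleteSpace H] (π : UnitaryRep G H)

theorem op_mul (g h : G) (ξ : H) : π.op (g * h) ξ = π.op g (π.op h ξ) := by
  simp [op]

theorem op_inv_op (g : G) (ξ : H) : π.op g⁻¹ (π.op g ξ) = ξ := by
  rw [← op_mul]
  simp [op]

theorem op_op_inv (g : G) (ξ : H) : π.op g (π.op g⁻¹ ξ) = ξ := by
  rw [← op_mul]
  simp [op]

theorem norm_op (g : G) (ξ : H) : ‖π.op g ξ‖ = ‖ξ‖ :=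
  Unitary.norm_map (π.toMonoidHom g) ξ

theorem inner_op_op (g : G) (ξ η : H) : inner ℂ (π.op g ξ) (π.op g η) = inner ℂ ξ η :=
  Unitary.inner_map_map (π.toMonoidHom g) ξ η

variable {π}

theorem invariants_mono {A B : Set Ω} (h : A ⊆ B) : π.invariants A ≤ π.invariants B :=
  fun _ hξ g hg => hξ g (fixingSubgroup_antitone G Ω h hg)

/-- Elements that agree on `A` act in the same way on the vectors invariant under `G_A`. -/
theorem op_eq_op_of_eqOn {A : Set Ω} {ξ : H} (hξ : ξ ∈ π.invariants A) {g h : G}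
    (hgh : ∀ a ∈ A, g • a = h • a) : π.op g ξ = π.op h ξ := by
  have h1 : π.op (h⁻¹ * g) ξ = ξ := hξ _ ((mem_fixingSubgroup_iff G).2 fun a ha => by
    rw [mul_smul, hgh a ha, inv_smul_smul])
  rw [op_mul] at h1
  rw [← op_op_inv π h (π.op g ξ), h1]

theorem op_mem_invariants_image {A : Set Ω} {ξ : H} (hξ : ξ ∈ π.invariants A) (g : G) :
    π.op g ξ ∈ π.invariants ((g • ·) '' A) := by
  intro h hh
  rw [← op_mul]
  refine op_eq_op_of_eqOn hξ fun a ha => ?_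
  rw [mul_smul]
  exact (mem_fixingSubgroup_iff G).1 hh _ ⟨a, ha, rfl⟩

theorem mem_invariants_of_op_mem {A : Set Ω} {ξ : H} {g : G}
    (h : π.op g ξ ∈ π.invariants ((g • ·) '' A)) : ξ ∈ π.invariants A := by
  have := op_mem_invariants_image h g⁻¹
  rwa [op_inv_op, Set.image_image, show (fun x : Ω => g⁻¹ • g • x) = id from
    funext fun x => inv_smul_smul g x, Set.image_id] at this

/-- The stabilizer of `ξ` in `G` is a subgroup containing `G_A` and `G_B`, hence their join. -/
theorem mem_invariants_inter (hWEI : WeaklyEliminatesImaginaries G) (hG : NoAlgebraicity G)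
    {A B : Set Ω} (hA : A.Finite) (hB : B.Finite) {ξ : H} (hξA : ξ ∈ π.invariants A)
    (hξB : ξ ∈ π.invariants B) : ξ ∈ π.invariants (A ∩ B) := by
  let S : Subgroup G :=
    { carrier := {g | π.op g ξ = ξ}
      one_mem' := by simp [op]
      mul_mem' := fun {a b} ha hb => by
        simp only [Set.mem_ofPred_eq] at ha hb ⊢
        rw [op_mul, hb, ha]
      inv_mem' := fun {a} ha => by
        simp only [Set.mem_ofPred_eq] at ha ⊢
        conv_lhs => rw [← ha]
        exact op_inv_op π a ξ }
  have hS : pointwiseStabilizer G A ⊔ pointwiseStabilizer G B ≤ S :=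
    sup_le (fun g hg => hξA g hg) (fun g hg => hξB g hg)
  exact fun g hg => hS (pointwiseStabilizer_inter_le_sup hWEI hG hA hB hg)

variable (π) in
/-- The closed span of the spaces `H_F`, where `F` runs through the finite subsets of `Y`. -/
noncomputable def finitaryInvariants (Y : Set Ω) : Submodule ℂ H :=
  (⨆ F : {F : Set Ω // F.Finite ∧ F ⊆ Y}, π.invariants F.1).topologicalClosure

instance hasOrthogonalProjection_finitaryInvariants (Y : Set Ω) :
    (π.finitaryInvariants Y).HasOrthogonalProjection :=
  haveI : CompleteSpace (π.finitaryInvariants Y) :=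
    (Submodule.isClosed_topologicalClosure _).completeSpace_coe
  inferInstance

/-- The family of the `H_F` is directed under unions of the `F`, so a single `H_F` suffices to
approximate a vector, with no sums. -/
theorem mem_finitaryInvariants_iff {Y : Set Ω} {ξ : H} :
    ξ ∈ π.finitaryInvariants Y ↔
      ∀ ε > 0, ∃ F : Set Ω, F.Finite ∧ F ⊆ Y ∧ ∃ η ∈ π.invariants F, ‖ξ - η‖ < ε := by
  have : Nonempty {F : Set Ω // F.Finite ∧ F ⊆ Y} := ⟨∅, Set.finite_empty, Set.empty_subset Y⟩
  have hdir : Directed (· ≤ ·)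
      fun F : {F : Set Ω // F.Finite ∧ F ⊆ Y} => π.invariants F.1 := fun F F' =>
    ⟨⟨F.1 ∪ F'.1, F.2.1.union F'.2.1, Set.union_subset F.2.2 F'.2.2⟩,
      invariants_mono Set.subset_union_left, invariants_mono Set.subset_union_right⟩
  rw [finitaryInvariants, ← SetLike.mem_coe, Submodule.topologicalClosure_coe,
    Metric.mem_closure_iff]
  simp only [SetLike.mem_coe, Submodule.mem_iSup_of_directed _ hdir, dist_eq_norm]
  refine forall₂_congr fun ε _ => ⟨?_, ?_⟩
  · rintro ⟨η, ⟨F, hF⟩, h⟩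
    exact ⟨F.1, F.2.1, F.2.2, η, hF, h⟩
  · rintro ⟨F, hF, hFY, η, hη, h⟩
    exact ⟨η, ⟨⟨F, hF, hFY⟩, hη⟩, h⟩

theorem invariants_le_finitaryInvariants {A Y : Set Ω} (hA : A.Finite) (h : A ⊆ Y) :
    π.invariants A ≤ π.finitaryInvariants Y := fun ξ hξ =>
  mem_finitaryInvariants_iff.2 fun ε hε => ⟨A, hA, h, ξ, hξ, by simpa using hε⟩

theorem op_mem_finitaryInvariants {Y : Set Ω} {g : G} (hg : ∀ y ∈ Y, g • y ∈ Y) {ξ : H}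
    (hξ : ξ ∈ π.finitaryInvariants Y) : π.op g ξ ∈ π.finitaryInvariants Y := by
  rw [mem_finitaryInvariants_iff] at hξ ⊢
  intro ε hε
  obtain ⟨F, hF, hFY, η, hη, h⟩ := hξ ε hε
  refine ⟨_, hF.image (g • ·), ?_, _, op_mem_invariants_image hη g, ?_⟩
  · rintro _ ⟨y, hy, rfl⟩
    exact hg y (hFY hy)
  · rwa [← map_sub, norm_op]

/-- The projection onto the closed span of the `H_F`, `F ⊆ Y`, commutes with the elements
preserving `Y`. -/
theorem op_starProjection_finitaryInvariants {Y : Set Ω} {g : G} (hg : ∀ y ∈ Y, g • y ∈ Y)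
    (hg' : ∀ y ∈ Y, g⁻¹ • y ∈ Y) (ξ : H) :
    π.op g ((π.finitaryInvariants Y).starProjection ξ) =
      (π.finitaryInvariants Y).starProjection (π.op g ξ) := by
  symm
  refine Submodule.eq_starProjection_of_mem_of_inner_eq_zero
    (op_mem_finitaryInvariants hg (Submodule.starProjection_apply_mem _ _)) fun w hw => ?_
  rw [← map_sub, ← op_op_inv π g w, inner_op_op]
  exact Submodule.starProjection_inner_eq_zero _ _ (op_mem_finitaryInvariants hg' hw)

/-- If `Y` is the complement of a set fixed by `G_B`, the projection onto the closed span of the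
`H_F`, `F ⊆ Y`, preserves `H_B`. -/
theorem starProjection_finitaryInvariants_mem {B Z : Set Ω} (hZ : Z ⊆ B) {ξ : H}
    (hξ : ξ ∈ π.invariants B) :
    (π.finitaryInvariants Zᶜ).starProjection ξ ∈ π.invariants B := by
  have key : ∀ g ∈ pointwiseStabilizer G B, ∀ y ∈ Zᶜ, g • y ∈ Zᶜ := by
    intro g hg y hy hgy
    have := (mem_fixingSubgroup_iff G).1 ((pointwiseStabilizer G B).inv_mem hg) _ (hZ hgy)
    rw [inv_smul_smul] at this
    exact hy (this ▸ hgy)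
  intro g hg
  rw [op_starProjection_finitaryInvariants (key g hg)
    (key _ ((pointwiseStabilizer G B).inv_mem hg)), hξ g hg]

end UnitaryRep

/-! ### Independent copies and dissociation. -/

/-- `G` has independent copies over cofinite sets: for each cofinite `Y ⊆ Ω` there are two maps
`Ω → Ω` in the closure of `G` that agree on `Y` and whose images are otherwise disjoint. -/
def HasIndependentCopies (G : Subgroup (Equiv.Perm Ω)) : Prop :=
  ∀ Y : Set Ω, Yᶜ.Finite → ∃ φ₁ φ₂ : Ω → Ω,
    (∀ F : Set Ω, F.Finite → ∃ g : G, ∀ a ∈ F, g • a = φ₁ a) ∧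
    (∀ F : Set Ω, F.Finite → ∃ g : G, ∀ a ∈ F, g • a = φ₂ a) ∧
    (∀ y ∈ Y, φ₁ y = φ₂ y) ∧ ∀ b₁ b₂, φ₁ b₁ = φ₂ b₂ → b₁ = b₂ ∧ b₁ ∈ Y

theorem HasIndependentCopies.noAlgebraicity {G : Subgroup (Equiv.Perm Ω)}
    (hG : HasIndependentCopies G) : NoAlgebraicity G := by
  intro A hA d hfin
  by_contra hd
  set O : Set Ω := {x | ∃ g ∈ pointwiseStabilizer G A, g • d = x}
  have hdO : d ∈ O := ⟨1, one_mem _, one_smul G d⟩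
  have hAO : ∀ a ∈ A, a ∉ O := by
    rintro a ha ⟨g, hg, hgd⟩
    have h1 : g • a = a := (mem_fixingSubgroup_iff G).1 hg a ha
    exact hd (MulAction.injective g (hgd.trans h1.symm) ▸ ha)
  -- Take copies that separate the finite orbit `O` of `d` and agree on `A`. Then `g₂⁻¹ * g₁` fixes
  -- `A`, so it maps `d` to some `x ∈ O` with `φ₁ d = φ₂ x`, against disjointness.
  obtain ⟨φ₁, φ₂, h₁, h₂, hY, hdisj⟩ := hG Oᶜ (by rwa [compl_compl])
  obtain ⟨g₁, hg₁⟩ := h₁ (A ∪ O) (hA.union hfin)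
  obtain ⟨g₂, hg₂⟩ := h₂ (A ∪ O) (hA.union hfin)
  have hmem : g₂⁻¹ * g₁ ∈ pointwiseStabilizer G A := (mem_fixingSubgroup_iff G).2 fun a ha => by
    rw [mul_smul, inv_smul_eq_iff, hg₁ a (Or.inl ha), hg₂ a (Or.inl ha), hY a (hAO a ha)]
  have hmemO : (g₂⁻¹ * g₁) • d ∈ O := ⟨_, hmem, rfl⟩
  have heq := hg₂ _ (Or.inr hmemO)
  rw [mul_smul, smul_inv_smul, hg₁ d (Or.inr hdO)] at heq
  exact (hdisj _ _ heq).2 hdO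

namespace UnitaryRep

variable {G : Subgroup (Equiv.Perm Ω)} {H : Type x}
  [NormedAddCommGroup H] [InnerProductSpace ℂ H] [CompleteSpace H] {π : UnitaryRep G H}

/-- A vector of `H_B` in the closed span of the `H_F` with `F` disjoint from `Z` is invariant under
the stabilizer of `B \ Z`. -/
theorem mem_invariants_diff (hWEI : WeaklyEliminatesImaginaries G) (hG : HasIndependentCopies G)
    {B Z : Set Ω} (hB : B.Finite) (hZ : Z.Finite) {ξ : H} (hξ : ξ ∈ π.invariants B)
    (hξZ : ξ ∈ π.finitaryInvariants Zᶜ) : ξ ∈ π.invariants (B \ Z) := by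
  obtain ⟨φ₁, φ₂, h₁, h₂, hY, hdisj⟩ := hG Zᶜ (by rwa [compl_compl])
  obtain ⟨g₁, hg₁⟩ := h₁ B hB
  obtain ⟨g₂, hg₂⟩ := h₂ B hB
  -- `ξ` is a limit of vectors `η` on which the two copies act alike; `k₁`, `k₂` extend the
  -- agreement with `φ₁`, `φ₂` from `B` to the support `F` of `η`.
  have heq : π.op g₁ ξ = π.op g₂ ξ := by
    refine eq_of_forall_dist_le fun ε hε => ?_
    obtain ⟨F, hF, hFZ, η, hη, hlt⟩ := mem_finitaryInvariants_iff.1 hξZ (ε / 2) (half_pos hε)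
    obtain ⟨k₁, hk₁⟩ := h₁ (B ∪ F) (hB.union hF)
    obtain ⟨k₂, hk₂⟩ := h₂ (B ∪ F) (hB.union hF)
    have e₁ : π.op g₁ ξ = π.op k₁ ξ := op_eq_op_of_eqOn hξ fun a ha => by
      rw [hg₁ a ha, hk₁ a (Or.inl ha)]
    have e₂ : π.op g₂ ξ = π.op k₂ ξ := op_eq_op_of_eqOn hξ fun a ha => by
      rw [hg₂ a ha, hk₂ a (Or.inl ha)]
    have e : π.op k₁ η = π.op k₂ η := op_eq_op_of_eqOn hη fun a ha => by
      rw [hk₁ a (Or.inr ha), hk₂ a (Or.inr ha), hY a (hFZ ha)]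
    calc dist (π.op g₁ ξ) (π.op g₂ ξ)
        = ‖π.op k₁ (ξ - η) - π.op k₂ (ξ - η)‖ := by
          rw [e₁, e₂, dist_eq_norm, map_sub, map_sub, e]
          abel_nf
      _ ≤ ‖π.op k₁ (ξ - η)‖ + ‖π.op k₂ (ξ - η)‖ := norm_sub_le _ _
      _ ≤ ε := by
          rw [norm_op, norm_op]
          linarith
  have hmem := mem_invariants_inter hWEI hG.noAlgebraicity (hB.image _) (hB.image _)
    (op_mem_invariants_image hξ g₁) (heq ▸ op_mem_invariants_image hξ g₂)
  refine mem_invariants_of_op_mem (g := g₁) (invariants_mono ?_ hmem)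
  rintro _ ⟨⟨b₁, hb₁, rfl⟩, ⟨b₂, hb₂, hb⟩⟩
  have h := hdisj b₁ b₂ (by rw [← hg₁ b₁ hb₁, ← hg₂ b₂ hb₂]; exact hb.symm)
  exact ⟨b₁, ⟨hb₁, h.2⟩, rfl⟩

theorem isDissociated_of_hasIndependentCopies (hWEI : WeaklyEliminatesImaginaries G)
    (hG : HasIndependentCopies G) : π.IsDissociated := by
  intro A B hA hB
  ext ξ
  set η := π.proj B ξ
  set ζ := (π.finitaryInvariants (B \ A)ᶜ).starProjection η
  have hηB : η ∈ π.invariants B := Submodule.starProjection_apply_mem _ _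
  have hAY : A ⊆ (B \ A)ᶜ := fun a ha h => h.2 ha
  have hζC : ζ ∈ π.invariants (A ∩ B) := by
    -- `G_B` preserves the complement of `B \ A`, so `ζ` stays in `H_B`; and `B \ (B \ A) = A ∩ B`.
    have := mem_invariants_diff hWEI hG (Z := B \ A) (ξ := ζ) hB hB.sdiff
      (starProjection_finitaryInvariants_mem Set.sdiff_subset hηB)
      (Submodule.starProjection_apply_mem _ _)
    rwa [Set.sdiff_sdiff_right_self, Set.inter_comm] at this
  have hperp : ∀ w ∈ π.invariants A, inner ℂ (η - ζ) w = 0 := fun w hw =>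
    Submodule.starProjection_inner_eq_zero _ _ (invariants_le_finitaryInvariants hA hAY hw)
  have hleft : π.proj A η = ζ := Submodule.eq_starProjection_of_mem_of_inner_eq_zero
    (invariants_mono Set.inter_subset_left hζC) hperp
  have hright : π.proj (A ∩ B) ξ = ζ :=
    Submodule.eq_starProjection_of_mem_of_inner_eq_zero hζC fun w hw => by
      rw [← sub_add_sub_cancel ξ η ζ, inner_add_left,
        hperp w (invariants_mono Set.inter_subset_left hw), add_zero]
      exact Submodule.starProjection_inner_eq_zero _ _
        (invariants_mono Set.inter_subset_right hw)
  rw [ContinuousLinearMap.comp_apply, hright]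
  exact hleft

end UnitaryRep

end PermutationGroups

/-! ### From amalgamation to independent copies. -/

section Structures

variable {L : FirstOrder.Language.{u, v}} {M : Type w} [L.Structure M]

/-- In an ultrahomogeneous structure, each self-embedding agrees with an automorphism
on any finite set. -/
theorem exists_automorphism_eqOn (hM : L.IsUltrahomogeneous M) (φ : M ↪[L] M) {F : Set M}
    (hF : F.Finite) : ∃ g : automorphismGroup L M, ∀ a ∈ F, g • a = φ a := by
  let S := FirstOrder.Language.Substructure.closure L F
  obtain ⟨g, hg⟩ := hM S (FirstOrder.Language.Substructure.fg_closure hF) (φ.comp S.subtype)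
  refine ⟨⟨g.toEquiv, g, rfl⟩, fun a ha => ?_⟩
  exact (DFunLike.congr_fun hg ⟨a, FirstOrder.Language.Substructure.subset_closure ha⟩).symm

theorem SigmaSAP.hasIndependentCopies [L.IsRelational] [Countable M]
    (hM : L.IsUltrahomogeneous M) (hSAP : SigmaSAP L M) : HasIndependentCopies (automorphismGroup L M) := by
  intro Y hY
  let S := FirstOrder.Language.Substructure.closure L Y
  have hS : ∀ m, m ∈ S ↔ m ∈ Y :=
    FirstOrder.Language.Substructure.mem_closure_iff_of_isRelational L Y
  have hrange : (Set.range S.subtype)ᶜ.Finite := by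
    refine hY.subset (Set.compl_subset_compl.2 fun y hy => ⟨⟨y, (hS y).2 hy⟩, rfl⟩)
  -- Both extensions are `M` itself over the substructure on `Y`; a closure adds no points in a
  -- relational language. Composing with `e : C ↪[L] M` brings the amalgam back into `M`.
  obtain ⟨C, g₁, g₂, ⟨-, ⟨e⟩⟩, hcomp, hstrong⟩ := hSAP ⟨S, inferInstance⟩ ⟨M, inferInstance⟩
    ⟨M, inferInstance⟩ S.subtype S.subtype ⟨inferInstanceAs (Countable S), ⟨S.subtype⟩⟩
    ⟨inferInstanceAs (Countable M), ⟨FirstOrder.Language.Embedding.refl L M⟩⟩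
    ⟨inferInstanceAs (Countable M), ⟨FirstOrder.Language.Embedding.refl L M⟩⟩ hrange hrange
  refine ⟨e.comp g₁, e.comp g₂, fun F hF => exists_automorphism_eqOn hM _ hF,
    fun F hF => exists_automorphism_eqOn hM _ hF, fun y hy => ?_, fun b₁ b₂ h => ?_⟩
  · exact congrArg e (DFunLike.congr_fun hcomp (⟨y, (hS y).2 hy⟩ : S))
  · obtain ⟨a, rfl, rfl⟩ := hstrong b₁ b₂ (e.injective h)
    exact ⟨rfl, (hS _).1 a.2⟩

end Structures

end Dissociation

theorem mainTheorem1 (L : FirstOrder.Language.{u, v}) [L.IsRelational]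
    (M : Type w) [L.Structure M] [Countable M]
    (hM : L.IsUltrahomogeneous M)
    (hWEI : Dissociation.WeaklyEliminatesImaginaries (Dissociation.automorphismGroup L M))
    (hSAP : Dissociation.SigmaSAP L M) :
    Dissociation.IsDissociated.{w, x} (Dissociation.automorphismGroup L M) :=
  fun _ _ _ _ _ => Dissociation.UnitaryRep.isDissociated_of_hasIndependentCopies hWEI
    (hSAP.hasIndependentCopies hM)
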